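/- **Setting.** Let $n\ge 2$, $l>0$, and let $(M,g)$ be an $(n+1)$-dimensional Lorentzian solution of $Ric-\frac R2 g+\Lambda g=0$ with $\Lambda=\frac{n(n-1)}{2l^2}$ that has a (spacelike) conformal infinity $\mathcal I^+$ with Riemannian boundary metric $\gamma$. Thus near $\mathcal I^+$ $$g=(l/\rho)^2(-d\rho^2+g_\rho),\qquad g_\rho\sim g_{(0)}+\rho^2g_{(2)}+\dots+\rho^n g_{(n)}+\rho^n\log\rho\,h_{(n)}+o(\rho^n),\quad g_{(0)}=\gamma,$$ where below order $n$ only even powers of $\rho$ occur and $h_{(n)}=0$ for $n$ odd. *Killing field.* Let $K$ be a nowhere vanishing (static or stationary) Killing field of $\gamma$ on $\mathcal I^+$ with a slice $S$ to its orbits; near $S$ (after unwrapping closed orbits), $\mathcal I^+$ is $\mathbb R\times S$ with $K=\partial_s$. *Continuation.* Let $g^{AH}=(l/\rho)^2(d\rho^2+g^{AH}_\rho)$ be an asymptotically hyperbolic (Riemannian) Einstein metric with $\Lambda=-\frac{n(n-1)}{2l^2}$, conformal infinity $\mathcal I^+$, and an expansion of the same form, that is related to $g$ by the formal substitution $\rho\to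 i\rho$, $l\to il$ with factors $i$ dropped: $$g_{(k)}=\sigma_k\,g^{AH}_{(k)}\ (k\le n),\qquad h_{(n)}=(-1)^{n/2}h^{AH}_{(n)}\ (n \text{ even}),$$ where $\sigma_k=+1$ for $k\equiv0,1$ and $\sigma_k=-1$ for $k\equiv2,3\pmod 4$. *Wick rotation.* Assume that $K=\partial_\theta$ is a Killing field of $g^{AH}$ near infinity (that is, of all $g^{AH}_\rho$), and let $g^{AdS}$ be the Einstein metric obtained by the substitution $\theta=it$. If $K$ is static for $g^{AH}$, this is a real Lorentzian AdS metric. If $K$ is only stationary, $g^{AdS}$ is the complex-valued metric given by the substitution. *Masses.* With respect to $\gamma$ (respectively to the Wick rotation of $\gamma$) the mass is $$m=\int_S\langle T(K),\nu\rangle\,dA ,$$ where $\nu$ is the unit normal to $S$ in the direction of $K$, with $\langle\nu,\nu\rangle=1$ for $m_{dS}$ and $\langle\nu,\nu\rangle=-1$ for $m_{AdS}$; $K=\partial_s$ for $m_{dS}$ and $K=\partial_t$ for $m_{AdS}$; $dA$ is the volume measure of $S$; and $$T=\mp\frac{n}{16\pi G}\,(g_{(n)}+r_{(n)}),$$ with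 the sign $-$ for $g$ and $+$ for $g^{AdS}$ and the respective coefficients $g_{(k)}$. Here $r_{(n)}=0$ for $n$ odd, $r_{(2)}=-(\mathrm{tr}\,g_{(2)})\,g_{(0)}$, and $r_{(4)}=-\frac18\big[(\mathrm{tr}\,g_{(2)})^2-\mathrm{tr}\,g_{(2)}^2\big]g_{(0)}-\frac12 g_{(2)}^2+\frac14(\mathrm{tr}\,g_{(2)})\,g_{(2)}$, traces and products being taken with $g_{(0)}$. Both integrals are assumed to converge (which is automatic if $S$ is compact). **Proposition 5.1.** If $n$ is odd, then $$m_{dS}=-m_{AdS}\ \text{ if } n\equiv 3\ (\mathrm{mod}\ 4),\qquad m_{dS}=m_{AdS}\ \text{ if } n\equiv 1\ (\mathrm{mod}\ 4).$$ Also $$m_{dS}=-m_{AdS}\ \text{ if } n=2,\qquad m_{dS}=m_{AdS}\ \text{ if } n=4 .$$ -/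

import Mathlib

open scoped Manifold ContDiff Topology Matrix
open MeasureTheory

namespace Holographic

noncomputable section

/-! ### Tensor fields and the Einstein equation -/

/-- Fields of `𝕜`-valued bilinear forms on the tangent spaces of a manifold. For `𝕜 = ℂ` these
are sections of the complexification of the bundle of bilinear forms (complex metrics). -/
abbrev FormField (𝕜 : Type*) [RCLike 𝕜] {E : Type*} [NormedAddCommGroup E] [NormedSpace ℝ E]
    {H : Type*} [TopologicalSpace H] (I : ModelWithCorners ℝ E H)
    (X : Type*) [TopologicalSpace X] [ChartedSpace H X] :=
  (x : X) → TangentSpace I x →ₗ[ℝ] TangentSpace I x →ₗ[ℝ] 𝕜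

section Coordinates

variable {𝕜 : Type*} [RCLike 𝕜] {E : Type*} [NormedAddCommGroup E] [NormedSpace ℝ E]
  {H : Type*} [TopologicalSpace H] {I : ModelWithCorners ℝ E H}
  {X : Type*} [TopologicalSpace X] [ChartedSpace H X] {ι : Type*} [Fintype ι] [DecidableEq ι]

/-- The components `g_ij` of a bilinear form field in the preferred chart at `x₀`, as functions of
the point `y` of the model space; the coordinate vectors are the members of the basis `b`. -/
def chartComp (b : Module.Basis ι ℝ E) (g : FormField 𝕜 I X) (x₀ : X) (y : E) : Matrix ι ι 𝕜 :=
  fun i j => g ((extChartAt I x₀).symm y)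
    (mfderiv 𝓘(ℝ, E) I (extChartAt I x₀).symm y (b i))
    (mfderiv 𝓘(ℝ, E) I (extChartAt I x₀).symm y (b j))

/-- The partial derivative in the direction of the `i`-th member of the basis. -/
def partialD (b : Module.Basis ι ℝ E) (i : ι) (f : E → 𝕜) (y : E) : 𝕜 :=
  fderiv ℝ f y (b i)

/-- Christoffel symbols
`Γ^k_ij = (1/2) ∑_l g^{kl} (∂_i g_jl + ∂_j g_il - ∂_l g_ij)`. -/
def christoffel (b : Module.Basis ι ℝ E) (G : E → Matrix ι ι 𝕜) (k i j : ι) (y : E) : 𝕜 :=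
  (1 / 2) * ∑ l, (G y)⁻¹ k l *
    (partialD b i (fun z => G z j l) y + partialD b j (fun z => G z i l) y
      - partialD b l (fun z => G z i j) y)

/-- Ricci curvature
`R_ij = ∑_k (∂_k Γ^k_ij - ∂_j Γ^k_ik) + ∑_{k,l} (Γ^k_kl Γ^l_ij - Γ^k_jl Γ^l_ik)`
(positive for round spheres). -/
def ricci (b : Module.Basis ι ℝ E) (G : E → Matrix ι ι 𝕜) (y : E) : Matrix ι ι 𝕜 :=
  fun i j =>
    ∑ k, (partialD b k (christoffel b G k i j) y - partialD b j (christoffel b G k i k) y)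
    + ∑ k, ∑ l, (christoffel b G k k l y * christoffel b G l i j y
        - christoffel b G k j l y * christoffel b G l i k y)

/-- Scalar curvature, the trace of the Ricci curvature. -/
def scalarCurvature (b : Module.Basis ι ℝ E) (G : E → Matrix ι ι 𝕜) (y : E) : 𝕜 :=
  ((G y)⁻¹ * ricci b G y).trace

/-- A smooth, symmetric, nondegenerate form field (a pseudo-Riemannian metric if `𝕜 = ℝ`, a complex
metric if `𝕜 = ℂ`). -/
structure IsMetric [FiniteDimensional ℝ E] (g : FormField 𝕜 I X) : Prop where
  symm : ∀ (x : X) (u v : TangentSpace I x), g x u v = g x v u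
  smooth : ∀ (x₀ : X) (i j : Fin (Module.finrank ℝ E)),
    ContDiffOn ℝ ∞ (fun y => chartComp (Module.finBasis ℝ E) g x₀ y i j) (extChartAt I x₀).target
  nondegenerate : ∀ x₀ : X,
    (chartComp (Module.finBasis ℝ E) g x₀ (extChartAt I x₀ x₀)).det ≠ 0

/-- The vacuum Einstein equation `Ric - (R/2) g + Λ g = 0` with cosmological constant `Λ`. -/
def IsEinstein [FiniteDimensional ℝ E] (Λ : ℝ) (g : FormField 𝕜 I X) : Prop :=
  ∀ x₀ : X,
    let b := Module.finBasis ℝ E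
    let G := chartComp b g x₀
    let y := extChartAt I x₀ x₀
    ricci b G y - (scalarCurvature b G y / 2) • G y + (Λ : 𝕜) • G y = 0

/-- Positive definite form fields. -/
def IsRiemannian (g : FormField ℝ I X) : Prop :=
  ∀ (x : X) (u : TangentSpace I x), u ≠ 0 → 0 < g x u u

/-- Form fields of signature `(-,+,…,+)`. -/
def IsLorentzian (g : FormField ℝ I X) : Prop :=
  ∀ x : X, ∃ u : TangentSpace I x, g x u u < 0 ∧
    ∀ w : TangentSpace I x, w ≠ 0 → g x u w = 0 → 0 < g x w w

end Coordinates

/-- The Riemannian volume measure of a metric `h` on a `d`-manifold: in every chart it is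
`√(det h_ij)` times Lebesgue measure. -/
def IsRiemannianVolume {d : ℕ} {S : Type*} [TopologicalSpace S]
    [ChartedSpace (EuclideanSpace ℝ (Fin d)) S] [MeasurableSpace S]
    (h : FormField ℝ (𝓡 d) S) (μ : Measure S) : Prop :=
  ∀ (x₀ : S) (A : Set S), MeasurableSet A → A ⊆ (extChartAt (𝓡 d) x₀).source →
    μ A = ∫⁻ y in extChartAt (𝓡 d) x₀ '' A, ENNReal.ofReal
      √(chartComp (EuclideanSpace.basisFun (Fin d) ℝ).toBasis h x₀ y).det

/-! ### Conformal infinity and the Fefferman–Graham expansion -/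

/-- The curve `q ρ` of form fields on the boundary has, as `ρ → 0+`, the expansion
`q_ρ ~ g_(0) + ρ² g_(2) + ⋯ + ρⁿ g_(n) + ρⁿ log ρ h_(n) + o(ρⁿ)`,
even in `ρ` below order `n`, and with `h_(n) = 0` if `n` is odd. (Only the terms up to order `n` are
recorded; `c k` has no meaning for `k > n`.) -/
structure HasFGExpansion {𝕜 : Type*} [RCLike 𝕜] {E : Type*} [NormedAddCommGroup E]
    [NormedSpace ℝ E] {H : Type*} [TopologicalSpace H] {I : ModelWithCorners ℝ E H}
    {B : Type*} [TopologicalSpace B] [ChartedSpace H B]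
    (n : ℕ) (q : ℝ → FormField 𝕜 I B) (c : ℕ → FormField 𝕜 I B) (h : FormField 𝕜 I B) :
    Prop where
  asymptotic : ∀ (x : B) (u v : TangentSpace I x),
    (fun ρ : ℝ => q ρ x u v - (∑ k ∈ Finset.range (n + 1), ((ρ ^ k : ℝ) : 𝕜) * c k x u v)
        - ((ρ ^ n * Real.log ρ : ℝ) : 𝕜) * h x u v) =o[𝓝[>] 0] fun ρ : ℝ => ρ ^ n
  odd_eq_zero : ∀ k < n, Odd k → c k = 0
  log_eq_zero : Odd n → h = 0

/-- An Einstein metric on the `(n+1)`-manifold `M`, together with a conformal infinity `B` (an open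
part of `∂M`, of dimension `n`) and the geodesic compactification belonging to a boundary metric
`g_(0)` on `B`. Near `B` the metric is
`g = (l/ρ)² (κ dρ² + g_ρ)`, and the cosmological constant is `Λ = -κ n(n-1)/(2l²)`:
`κ = -1` is the de Sitter case, `κ = 1` the anti-de Sitter and asymptotically hyperbolic case.
Real metrics are `𝕜 = ℝ`; the case `𝕜 = ℂ` of complex metrics is used for Wick rotations. -/
structure EinsteinEnd (𝕜 : Type*) [RCLike 𝕜] (n : ℕ) (κ l : ℝ)
    (M : Type*) [TopologicalSpace M] [ChartedSpace (EuclideanSpace ℝ (Fin (n + 1))) M]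
    {E : Type*} [NormedAddCommGroup E] [NormedSpace ℝ E] [FiniteDimensional ℝ E]
    {H : Type*} [TopologicalSpace H] (I : ModelWithCorners ℝ E H)
    (B : Type*) [TopologicalSpace B] [ChartedSpace H B] where
  /-- the metric on `M` -/
  metric : FormField 𝕜 (𝓡 (n + 1)) M
  isMetric : IsMetric metric
  isEinstein : IsEinstein (-κ * (n * (n - 1) / (2 * l ^ 2))) metric
  /-- the width of the collar -/
  ε : ℝ
  ε_pos : 0 < ε
  /-- the collar `(0, ε) × B → M` -/
  collar : ℝ × B → M
  collar_smooth : ContMDiffOn (𝓘(ℝ, ℝ).prod I) (𝓡 (n + 1)) ∞ collar (Set.Ioo 0 ε ×ˢ Set.univ)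
  collar_injOn : Set.InjOn collar (Set.Ioo 0 ε ×ˢ Set.univ)
  /-- the points of `B` lie at infinity: gluing `B` to `M` at `ρ = 0` gives a Hausdorff space -/
  collar_infinity : ∀ (b : B) (x : M), Disjoint (Filter.map collar (𝓝[>] (0 : ℝ) ×ˢ 𝓝 b)) (𝓝 x)
  /-- the curve `g_ρ` of form fields on `B` -/
  family : ℝ → FormField 𝕜 I B
  /-- `g = (l/ρ)² (κ dρ² + g_ρ)` on the collar -/
  metric_collar : ∀ (ρ : ℝ) (x : B), 0 < ρ → ρ < ε → ∀ (a a' : ℝ) (u u' : TangentSpace I x),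
    metric (collar (ρ, x))
        (mfderiv (𝓘(ℝ, ℝ).prod I) (𝓡 (n + 1)) collar (ρ, x) (a, u))
        (mfderiv (𝓘(ℝ, ℝ).prod I) (𝓡 (n + 1)) collar (ρ, x) (a', u'))
      = (((l / ρ) ^ 2 : ℝ) : 𝕜) * (((κ * a * a' : ℝ) : 𝕜) + family ρ x u u')
  /-- the coefficients `g_(k)`, `k ≤ n` -/
  coeff : ℕ → FormField 𝕜 I B
  /-- the coefficient `h_(n)` of `ρⁿ log ρ` -/
  logCoeff : FormField 𝕜 I B
  expansion : HasFGExpansion n family coeff logCoeff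
  isMetric_boundary : IsMetric (coeff 0)

/-- The sign with which the coefficient of `ρᵏ` is multiplied under `ρ → iρ` when resulting factors
`i` are dropped: `+` if `k ≡ 0, 1 (mod 4)` and `-` if `k ≡ 2, 3 (mod 4)`. -/
def continuationSign (k : ℕ) : ℝ := if k % 4 = 0 ∨ k % 4 = 1 then 1 else -1

/-- The metric `X` of de Sitter type and the asymptotically hyperbolic metric `Y`, with the same
conformal infinity and the same `l`, are continuations of each other: the formal expansion of one
arises from the other by `ρ → iρ`, `l → il`, dropping factors `i`. The coefficients up to order `n`
determine the later ones through the Einstein equation. -/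
structure IsContinuation {n : ℕ} {l : ℝ}
    {M : Type*} [TopologicalSpace M] [ChartedSpace (EuclideanSpace ℝ (Fin (n + 1))) M]
    {M' : Type*} [TopologicalSpace M'] [ChartedSpace (EuclideanSpace ℝ (Fin (n + 1))) M']
    {B : Type*} [TopologicalSpace B] [ChartedSpace (EuclideanSpace ℝ (Fin n)) B]
    (X : EinsteinEnd ℝ n (-1) l M (𝓡 n) B) (Y : EinsteinEnd ℝ n 1 l M' (𝓡 n) B) : Prop where
  coeff_eq : ∀ k ≤ n, ∀ b : B, X.coeff k b = continuationSign k • Y.coeff k b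
  log_eq : Even n → ∀ b : B, X.logCoeff b = ((-1 : ℝ) ^ (n / 2)) • Y.logCoeff b

/-! ### Killing fields and Wick rotation -/

section Stationary

variable {n d : ℕ} {B : Type*} [TopologicalSpace B] [ChartedSpace (EuclideanSpace ℝ (Fin n)) B]
  {S : Type*} [TopologicalSpace S] [ChartedSpace (EuclideanSpace ℝ (Fin d)) S]

/-- The pull-back of a form field under a map `ℝ × S → B`. -/
def pullback {𝕜 : Type*} [RCLike 𝕜] (Ψ : ℝ × S → B) (q : FormField 𝕜 (𝓡 n) B) :
    FormField 𝕜 (𝓘(ℝ, ℝ).prod (𝓡 d)) (ℝ × S) := fun p =>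
  (q (Ψ p)).compl₁₂
    (mfderiv (𝓘(ℝ, ℝ).prod (𝓡 d)) (𝓡 n) Ψ p).toLinearMap
    (mfderiv (𝓘(ℝ, ℝ).prod (𝓡 d)) (𝓡 n) Ψ p).toLinearMap

/-- A form field on `ℝ × S` that is invariant under the translations of `ℝ`, that is, `∂_s` is a
Killing field of it: its components in adapted coordinates `(s, x)` do not depend on `s`. -/
def IsTranslationInvariant {𝕜 : Type*} [RCLike 𝕜]
    (q : FormField 𝕜 (𝓘(ℝ, ℝ).prod (𝓡 d)) (ℝ × S)) : Prop :=
  ∀ (s : ℝ) (x : S) (u v : ℝ × EuclideanSpace ℝ (Fin d)), q (s, x) u v = q (0, x) u v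

/-- `S` is a slice to the orbits of the nowhere vanishing vector field `K` on `B`, and `Ψ(s, x)` is
the flow of `K` for the time `s`, starting at the point `x` of the slice. (The orbits may be closed;
`Ψ` then unwraps them.) -/
structure IsSlice (K : (b : B) → TangentSpace (𝓡 n) b) (Ψ : ℝ × S → B) : Prop where
  smooth : ContMDiff (𝓘(ℝ, ℝ).prod (𝓡 d)) (𝓡 n) ∞ Ψ
  bijective_mfderiv : ∀ p : ℝ × S,
    Function.Bijective (mfderiv (𝓘(ℝ, ℝ).prod (𝓡 d)) (𝓡 n) Ψ p)
  mfderiv_eq : ∀ p : ℝ × S,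
    mfderiv (𝓘(ℝ, ℝ).prod (𝓡 d)) (𝓡 n) Ψ p ((1 : ℝ), (0 : EuclideanSpace ℝ (Fin d))) = K (Ψ p)
  orbit_unique : ∀ p p' : ℝ × S, Ψ p = Ψ p' → p.2 = p'.2

/-- The projection `(a, w) ↦ (a, 0)` of a tangent space of `ℝ × S`. -/
def timePart : (ℝ × EuclideanSpace ℝ (Fin d)) →ₗ[ℝ] (ℝ × EuclideanSpace ℝ (Fin d)) :=
  LinearMap.inl ℝ ℝ _ ∘ₗ LinearMap.fst ℝ ℝ _

/-- The projection `(a, w) ↦ (0, w)` of a tangent space of `ℝ × S`. -/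
def spacePart : (ℝ × EuclideanSpace ℝ (Fin d)) →ₗ[ℝ] (ℝ × EuclideanSpace ℝ (Fin d)) :=
  LinearMap.inr ℝ ℝ _ ∘ₗ LinearMap.snd ℝ ℝ _

/-- The substitution `dθ = i dt` in a bilinear form on `ℝ × F`, where `dθ` is the coordinate of the
factor `ℝ`: the value on `u`, `v` becomes
`i² r(u_0, v_0) + i r(u_0, v_1) + i r(u_1, v_0) + r(u_1, v_1)`, with `u_0 = timePart u`,
`u_1 = spacePart u`. -/
def wickForm (r : (ℝ × EuclideanSpace ℝ (Fin d)) →ₗ[ℝ] (ℝ × EuclideanSpace ℝ (Fin d)) →ₗ[ℝ] ℝ) :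
    (ℝ × EuclideanSpace ℝ (Fin d)) →ₗ[ℝ] (ℝ × EuclideanSpace ℝ (Fin d)) →ₗ[ℝ] ℂ :=
  let rC := r.compr₂ Complex.ofRealCLM.toLinearMap
  Complex.I ^ 2 • rC.compl₁₂ timePart timePart + Complex.I • rC.compl₁₂ timePart spacePart
    + Complex.I • rC.compl₁₂ spacePart timePart + rC.compl₁₂ spacePart spacePart

/-- In the static case, where `∂_θ` is orthogonal to the slices, the result is real: it is
`-N² dt² + h` if `r` is `N² dθ² + h`. -/
theorem wickForm_of_static
    (r : (ℝ × EuclideanSpace ℝ (Fin d)) →ₗ[ℝ] (ℝ × EuclideanSpace ℝ (Fin d)) →ₗ[ℝ] ℝ)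
    (h₁ : ∀ u v, r (timePart u) (spacePart v) = 0) (h₂ : ∀ u v, r (spacePart u) (timePart v) = 0)
    (u v : ℝ × EuclideanSpace ℝ (Fin d)) :
    wickForm r u v = ((-r (timePart u) (timePart v) + r (spacePart u) (spacePart v) : ℝ) : ℂ) := by
  simp [wickForm, h₁, h₂]

/-- The form field on `ℝ × S`, with coordinates `(t, x)`, which results from a translation invariant
form field with coordinates `(θ, x)` by the substitution `θ = it`, `dθ = i dt`. It is in general
complex-valued: `N² dθ² + h_jk (dx_j + n_j dθ)(dx_k + n_k dθ)` becomes
`-N² dt² + h_jk (dx_j + i n_j dt)(dx_k + i n_k dt)`. -/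
def wick (q : FormField ℝ (𝓘(ℝ, ℝ).prod (𝓡 d)) (ℝ × S)) :
    FormField ℂ (𝓘(ℝ, ℝ).prod (𝓡 d)) (ℝ × S) := fun p => wickForm (q p)

/-- The components of a form field on `ℝ × S` at the point `x` of the slice `{0} × S`. The index
`inl ()` belongs to `K = ∂_s`, the indices `inr j` to a basis of `T_x S`. -/
def sliceComp {𝕜 : Type*} [RCLike 𝕜] (q : FormField 𝕜 (𝓘(ℝ, ℝ).prod (𝓡 d)) (ℝ × S)) (x : S) :
    Matrix (Unit ⊕ Fin d) (Unit ⊕ Fin d) 𝕜 :=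
  let e : Unit ⊕ Fin d → ℝ × EuclideanSpace ℝ (Fin d) :=
    Sum.elim (fun _ => (1, 0)) (fun j => (0, EuclideanSpace.single j 1))
  fun i j => q (0, x) (e i) (e j)

/-- The metric induced on the slice `{0} × S`. (The restriction of a Wick rotation to vectors tangent
to the slice is real, so nothing is lost by taking real parts.) -/
def sliceMetric {𝕜 : Type*} [RCLike 𝕜] (q : FormField 𝕜 (𝓘(ℝ, ℝ).prod (𝓡 d)) (ℝ × S)) :
    FormField ℝ (𝓡 d) S := fun x =>
  let r : (ℝ × EuclideanSpace ℝ (Fin d)) →ₗ[ℝ] (ℝ × EuclideanSpace ℝ (Fin d)) →ₗ[ℝ] 𝕜 := q (0, x)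
  (r.compl₁₂ (LinearMap.inr ℝ ℝ (EuclideanSpace ℝ (Fin d)))
    (LinearMap.inr ℝ ℝ (EuclideanSpace ℝ (Fin d)))).compr₂ RCLike.reLm

end Stationary

/-- The complex Einstein metric `Z` (with `Λ < 0`) is the Wick rotation, `θ = it`, of the
asymptotically hyperbolic Einstein metric `Y`, where `∂_θ = K` is a Killing field of `Y` near
infinity. With `Ψ` as in `IsSlice`, the metrics are
`(l/ρ)² (dρ² + Ψ^* g_ρ)` on `(0, ε) × ℝ × S` for `Y` and `(l/ρ)² (dρ² + wick (Ψ^* g_ρ))` for `Z`. -/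
structure IsWickRotation {n d : ℕ} {l : ℝ}
    {M : Type*} [TopologicalSpace M] [ChartedSpace (EuclideanSpace ℝ (Fin (n + 1))) M]
    {M' : Type*} [TopologicalSpace M'] [ChartedSpace (EuclideanSpace ℝ (Fin (n + 1))) M']
    {B : Type*} [TopologicalSpace B] [ChartedSpace (EuclideanSpace ℝ (Fin n)) B]
    {S : Type*} [TopologicalSpace S] [ChartedSpace (EuclideanSpace ℝ (Fin d)) S]
    (Ψ : ℝ × S → B) (Y : EinsteinEnd ℝ n 1 l M (𝓡 n) B)
    (Z : EinsteinEnd ℂ n 1 l M' (𝓘(ℝ, ℝ).prod (𝓡 d)) (ℝ × S)) : Prop where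
  stationary : ∀ ρ : ℝ, 0 < ρ → ρ < Y.ε → IsTranslationInvariant (pullback (d := d) Ψ (Y.family ρ))
  family_eq : ∀ ρ : ℝ, 0 < ρ → ρ < Y.ε → ρ < Z.ε → Z.family ρ = wick (pullback Ψ (Y.family ρ))

/-! ### The holographic stress-energy tensor and the mass -/

section Mass

variable {𝕜 : Type*} [RCLike 𝕜] {ι : Type*} [Fintype ι] [DecidableEq ι]

/-- The term `r_(n)` of the holographic stress-energy tensor, in components, from the coefficients
`c k = g_(k)` of the expansion; traces and products are taken with `γ = g_(0)`. It is `0` for odd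
`n`, `-(tr g_(2)) γ` for `n = 2`, and
`-(1/8) ((tr g_(2))² - tr (g_(2)²)) γ - (1/2) g_(2)² + (1/4) (tr g_(2)) g_(2)` for `n = 4`.
Even `n ≥ 6` are not needed. -/
def rTerm (n : ℕ) (c : ℕ → Matrix ι ι 𝕜) : Matrix ι ι 𝕜 :=
  if n = 2 then
    -(((c 0)⁻¹ * c 2).trace • c 0)
  else if n = 4 then
    -((1 / 8 : 𝕜) • ((((c 0)⁻¹ * c 2).trace ^ 2
        - ((c 0)⁻¹ * c 2 * ((c 0)⁻¹ * c 2)).trace) • c 0))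
      - (1 / 2 : 𝕜) • (c 2 * (c 0)⁻¹ * c 2)
      + (1 / 4 : 𝕜) • (((c 0)⁻¹ * c 2).trace • c 2)
  else 0

/-- The holographic stress-energy tensor `T = sgn * n / (16 π G) * (g_(n) + r_(n))`. The sign is `-1`
for asymptotically hyperbolic and for de Sitter metrics, and `+1` for anti-de Sitter metrics. -/
def stressEnergy (sgn : ℝ) (n : ℕ) (G : ℝ) (c : ℕ → Matrix ι ι 𝕜) : Matrix ι ι 𝕜 :=
  ((sgn * (n / (16 * Real.pi * G)) : ℝ) : 𝕜) • (c n + rTerm n c)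

/-- `ν` is the unit normal of the slice in the direction of `K`: it is orthogonal to `T_x S`, has
`γ(ν, ν) = κ`, with `κ = 1` for Riemannian and `κ = -1` for Lorentzian `γ`, and its component along
`K` is positive. -/
structure IsUnitNormal {d : ℕ} (κ : ℝ) (γ : Matrix (Unit ⊕ Fin d) (Unit ⊕ Fin d) 𝕜)
    (ν : Unit ⊕ Fin d → 𝕜) : Prop where
  orthogonal : ∀ j : Fin d, (γ *ᵥ ν) (Sum.inr j) = 0
  norm_eq : ν ⬝ᵥ (γ *ᵥ ν) = (κ : 𝕜)
  pos : ∃ a : ℝ, 0 < a ∧ ν (Sum.inl ()) = (a : 𝕜)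

/-- The integral `m = ∫_S ⟨T(K), ν⟩ dA` exists and has the value `m`. Here `K = ∂_s` on `ℝ × S`, the
`c k` are the coefficients of the expansion with respect to the boundary metric `γ = c 0` on `ℝ × S`,
`T` is the stress-energy tensor with the sign `sgn`, `ν` is the unit normal of `S` with
`γ(ν, ν) = κ`, and `dA` is the volume measure of the metric induced by `γ` on `S`. -/
def HasMass {d : ℕ} {S : Type*} [TopologicalSpace S] [ChartedSpace (EuclideanSpace ℝ (Fin d)) S]
    [MeasurableSpace S] (sgn κ : ℝ) (n : ℕ) (G : ℝ)
    (c : ℕ → FormField 𝕜 (𝓘(ℝ, ℝ).prod (𝓡 d)) (ℝ × S)) (m : 𝕜) : Prop :=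
  ∃ (dA : Measure S) (ν : S → Unit ⊕ Fin d → 𝕜),
    IsRiemannianVolume (sliceMetric (c 0)) dA ∧
    (∀ x : S, IsUnitNormal κ (sliceComp (c 0) x) (ν x)) ∧
    Integrable (fun x =>
      (stressEnergy sgn n G (fun k => sliceComp (c k) x) *ᵥ ν x) (Sum.inl ())) dA ∧
    ∫ x, (stressEnergy sgn n G (fun k => sliceComp (c k) x) *ᵥ ν x) (Sum.inl ()) ∂dA = m

end Mass

end

end Holographic

open Holographic

/-!
In the frame `(K, ∂_1, …, ∂_d)` along the slice the theorem is a statement about matrices. Write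
`A k`, `A' k`, `C k` for the components of the coefficients `g_(k)` of the de Sitter, asymptotically
hyperbolic and anti-de Sitter metrics, and `D = diag(i, 1, …, 1)`. The continuation `ρ → iρ` gives
`A k = σ_k • A' k` with `σ_k = continuationSign k`. The Wick rotation is imposed on the metrics `g_ρ`
for `ρ > 0`; uniqueness of expansions in `1, ρ, …, ρⁿ, ρⁿ log ρ` modulo `o(ρⁿ)`
(`eq_zero_of_expansion_isLittleO`) transfers it to the coefficients, so `C k = D * A' k * D` for
`k ≤ n` (`IsWickRotation.coeff_eq`, `sliceComp_wick`).

Since `r_(n)` is built covariantly from `g_(0)` and `g_(2)`, the tensor `g_(n) + r_(n)` is multiplied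
by `σ_n` under the continuation when `n` is odd, `2` or `4` (`rTerm_continuation`), and is conjugated
by `D` under the Wick rotation (`rTerm_conj`). The unit normals are related by `D ν' = i ν`
(`IsUnitNormal.wickMatrix_mulVec`). So `⟨T(K), ν⟩` is multiplied by `i · i = -1` under the Wick
rotation; this cancels the opposite signs in the definitions of the two tensors `T`, and the mass
densities differ exactly by the factor `σ_n` (`stressEnergy_continuation`). The metrics induced on `S`
coincide, hence so do the volume measures (`IsRiemannianVolume.unique`), and integration gives
`m_dS = σ_n m_AdS`.
-/

namespace Holographic

open Filter Matrix

/-! ### Uniqueness of asymptotic expansions with one logarithmic term -/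

/-- The functions `1, ρ, …, ρⁿ, ρⁿ log ρ` are asymptotically independent modulo `o(ρⁿ)`. By induction
on `n`: the limit at `0` isolates `a 0`, and dividing by `ρ` lowers `n`. -/
theorem eq_zero_of_expansion_isLittleO {V : Type*} [NormedAddCommGroup V] [NormedSpace ℝ V]
    (n : ℕ) (a : ℕ → V) (b : V)
    (h : (fun ρ : ℝ => (∑ k ∈ Finset.range (n + 1), ρ ^ k • a k) + (ρ ^ n * Real.log ρ) • b)
      =o[𝓝[>] 0] fun ρ : ℝ => ρ ^ n) :
    (∀ k ≤ n, a k = 0) ∧ b = 0 := by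
  induction n generalizing a with
  | zero =>
    simp only [zero_add, Finset.range_one, Finset.sum_singleton, pow_zero, one_smul, one_mul,
      Asymptotics.isLittleO_one_iff] at h
    -- dividing by `log ρ → -∞` isolates `b`
    have hlog : Tendsto (fun ρ : ℝ => (Real.log ρ)⁻¹) (𝓝[>] 0) (𝓝 0) :=
      tendsto_inv_atBot_zero.comp Real.tendsto_log_nhdsGT_zero
    have hb : b = 0 := by
      have h1 := (hlog.smul h).sub (hlog.smul_const (a 0))
      rw [smul_zero, zero_smul, sub_zero] at h1
      refine tendsto_nhds_unique (tendsto_const_nhds.congr' ?_) h1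
      filter_upwards [Real.tendsto_log_nhdsGT_zero.eventually (eventually_lt_atBot 0)] with ρ hρ
      rw [smul_add, smul_smul, inv_mul_cancel₀ hρ.ne, one_smul, add_sub_cancel_left]
    subst hb
    refine ⟨fun k hk => ?_, rfl⟩
    obtain rfl : k = 0 := by omega
    simpa using h
  | succ n ih =>
    have hsplit : ∀ ρ : ℝ, (∑ k ∈ Finset.range (n + 1 + 1), ρ ^ k • a k)
        + (ρ ^ (n + 1) * Real.log ρ) • b
        = a 0 + ρ • ((∑ k ∈ Finset.range (n + 1), ρ ^ k • a (k + 1))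
          + (ρ ^ n * Real.log ρ) • b) := fun ρ => by
      rw [Finset.sum_range_succ', smul_add, Finset.smul_sum]
      simp only [smul_smul, pow_succ', pow_zero, one_smul, mul_assoc]
      abel
    have hρ : Tendsto (fun ρ : ℝ => ρ) (𝓝[>] 0) (𝓝 0) :=
      tendsto_nhdsWithin_of_tendsto_nhds tendsto_id
    have h0 : a 0 = 0 := by
      have hlim : Tendsto (fun ρ : ℝ => (∑ k ∈ Finset.range (n + 1 + 1), ρ ^ k • a k)
          + (ρ ^ (n + 1) * Real.log ρ) • b) (𝓝[>] 0) (𝓝 0) :=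
        h.trans_tendsto (by simpa using hρ.pow (n + 1))
      have h1 : Tendsto (fun ρ : ℝ => ∑ k ∈ Finset.range (n + 1), ρ ^ k • a (k + 1)) (𝓝[>] 0)
          (𝓝 (∑ k ∈ Finset.range (n + 1), (0 : ℝ) ^ k • a (k + 1))) :=
        tendsto_finsetSum _ fun k _ => (hρ.pow k).smul_const _
      have h2 : Tendsto (fun ρ : ℝ => ρ ^ n * (Real.log ρ * ρ)) (𝓝[>] 0) (𝓝 0) := by
        simpa using (hρ.pow n).mul (tendsto_log_mul_rpow_nhdsGT_zero one_pos)
      have h3 := ((hρ.smul h1).add (h2.smul_const b)).const_add (a 0)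
      rw [zero_smul, zero_smul, add_zero, add_zero] at h3
      refine tendsto_nhds_unique h3 (hlim.congr fun ρ => ?_)
      rw [hsplit, smul_add, smul_smul]
      congr 3
      ring
    have h' : (fun ρ : ℝ => (∑ k ∈ Finset.range (n + 1), ρ ^ k • a (k + 1))
        + (ρ ^ n * Real.log ρ) • b) =o[𝓝[>] 0] fun ρ : ℝ => ρ ^ n := by
      refine ((Asymptotics.isBigO_refl (fun ρ : ℝ => ρ⁻¹) (𝓝[>] 0)).smul_isLittleO h).congr' ?_ ?_
      · filter_upwards [self_mem_nhdsWithin] with ρ (hρ : 0 < ρ)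
        rw [hsplit, h0, zero_add, smul_smul, inv_mul_cancel₀ hρ.ne', one_smul]
      · filter_upwards [self_mem_nhdsWithin] with ρ (hρ : 0 < ρ)
        rw [smul_eq_mul, pow_succ', inv_mul_cancel_left₀ hρ.ne']
    obtain ⟨h1, h2⟩ := ih _ h'
    refine ⟨fun k hk => ?_, h2⟩
    cases k with
    | zero => exact h0
    | succ k => exact h1 k (by omega)

section Expansion

variable {𝕜 : Type*} [RCLike 𝕜] {E : Type*} [NormedAddCommGroup E] [NormedSpace ℝ E]
  {H : Type*} [TopologicalSpace H] {I : ModelWithCorners ℝ E H}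
  {B : Type*} [TopologicalSpace B] [ChartedSpace H B] {n : ℕ}

/-- The coefficients up to order `n` of a Fefferman–Graham expansion are determined by its asymptotics
alone; the comparison expansion need not satisfy the parity conditions. -/
theorem HasFGExpansion.coeff_unique {q : ℝ → FormField 𝕜 I B} {c c' : ℕ → FormField 𝕜 I B}
    {h h' : FormField 𝕜 I B} (hc : HasFGExpansion n q c h)
    (hc' : ∀ (x : B) (u v : TangentSpace I x),
      (fun ρ : ℝ => q ρ x u v - (∑ k ∈ Finset.range (n + 1), ((ρ ^ k : ℝ) : 𝕜) * c' k x u v)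
        - ((ρ ^ n * Real.log ρ : ℝ) : 𝕜) * h' x u v) =o[𝓝[>] 0] fun ρ : ℝ => ρ ^ n)
    {k : ℕ} (hk : k ≤ n) : c k = c' k := by
  funext x
  ext u v
  have hsub := (hc' x u v).sub (hc.asymptotic x u v)
  refine sub_eq_zero.1 ((eq_zero_of_expansion_isLittleO n
    (fun k => c k x u v - c' k x u v) (h x u v - h' x u v) (hsub.congr_left fun ρ => ?_)).1 k hk)
  simp only [RCLike.real_smul_eq_coe_mul, mul_sub, Finset.sum_sub_distrib]
  ring

end Expansion

/-! ### The substitution `θ = it` in components -/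

section Wick

variable {d : ℕ}

theorem wickForm_apply
    (r : (ℝ × EuclideanSpace ℝ (Fin d)) →ₗ[ℝ] (ℝ × EuclideanSpace ℝ (Fin d)) →ₗ[ℝ] ℝ)
    (u v : ℝ × EuclideanSpace ℝ (Fin d)) :
    wickForm r u v = -(r (timePart u) (timePart v) : ℂ)
      + Complex.I * (r (timePart u) (spacePart v) : ℂ)
      + Complex.I * (r (spacePart u) (timePart v) : ℂ) + (r (spacePart u) (spacePart v) : ℂ) := by
  simp [wickForm]

/-- The change of frame `diag(i, 1, …, 1)` on `T(ℝ × S)`: substituting `dθ = i dt` in a form with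
component matrix `A` gives the component matrix `wickMatrix d * A * wickMatrix d`. -/
noncomputable def wickMatrix (d : ℕ) : Matrix (Unit ⊕ Fin d) (Unit ⊕ Fin d) ℂ :=
  diagonal (Sum.elim (fun _ => Complex.I) fun _ => 1)

theorem isUnit_det_wickMatrix : IsUnit (wickMatrix d).det := by
  simp [wickMatrix, det_diagonal]

theorem wickForm_sumElim
    (r : (ℝ × EuclideanSpace ℝ (Fin d)) →ₗ[ℝ] (ℝ × EuclideanSpace ℝ (Fin d)) →ₗ[ℝ] ℝ)
    (b : Fin d → EuclideanSpace ℝ (Fin d)) (i j : Unit ⊕ Fin d) :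
    let e : Unit ⊕ Fin d → ℝ × EuclideanSpace ℝ (Fin d) :=
      Sum.elim (fun _ => (1, 0)) fun j => (0, b j)
    wickForm r (e i) (e j)
      = (wickMatrix d * (of fun i j => (r (e i) (e j) : ℂ)) * wickMatrix d) i j := by
  intro e
  rw [wickMatrix, mul_diagonal, diagonal_mul, of_apply, wickForm_apply]
  have ht (i) : timePart (e (Sum.inl i)) = e (Sum.inl i) := by simp [e, timePart]
  have hs (i) : spacePart (e (Sum.inl i)) = 0 := by simp [e, spacePart]
  have ht' (i) : timePart (e (Sum.inr i)) = 0 := by simp [e, timePart]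
  have hs' (i) : spacePart (e (Sum.inr i)) = e (Sum.inr i) := by simp [e, spacePart]
  rcases i with i | i <;> rcases j with j | j <;>
    simp only [ht, hs, ht', hs', map_zero, LinearMap.zero_apply, Sum.elim_inl, Sum.elim_inr,
      Complex.ofReal_zero]
  · linear_combination -(r (e (Sum.inl i)) (e (Sum.inl j)) : ℂ) * Complex.I_sq
  all_goals ring

theorem sliceComp_wick {S : Type*} [TopologicalSpace S]
    [ChartedSpace (EuclideanSpace ℝ (Fin d)) S]
    (q : FormField ℝ (𝓘(ℝ, ℝ).prod (𝓡 d)) (ℝ × S)) (x : S) :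
    sliceComp (wick q) x
      = wickMatrix d * (sliceComp q x).map Complex.ofReal * wickMatrix d := by
  ext i j
  exact wickForm_sumElim (q (0, x)) (fun j => EuclideanSpace.single j 1) i j

/-- The substitution `dθ = i dt` does not change the metric induced on the slice. -/
theorem sliceMetric_wick {S : Type*} [TopologicalSpace S]
    [ChartedSpace (EuclideanSpace ℝ (Fin d)) S]
    (q : FormField ℝ (𝓘(ℝ, ℝ).prod (𝓡 d)) (ℝ × S)) :
    sliceMetric (wick q) = sliceMetric q := by
  have key (r : (ℝ × EuclideanSpace ℝ (Fin d)) →ₗ[ℝ] (ℝ × EuclideanSpace ℝ (Fin d)) →ₗ[ℝ] ℝ)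
      (u v : EuclideanSpace ℝ (Fin d)) : RCLike.re (wickForm r (0, u) (0, v)) = r (0, u) (0, v) := by
    have h0 : ((0 : ℝ), (0 : EuclideanSpace ℝ (Fin d))) = 0 := rfl
    rw [wickForm_apply]
    simp [timePart, spacePart, h0]
  funext x
  ext u v
  exact key (q (0, x)) u v

theorem wickForm_isLittleO {n : ℕ}
    {r : ℝ → (ℝ × EuclideanSpace ℝ (Fin d)) →ₗ[ℝ] (ℝ × EuclideanSpace ℝ (Fin d)) →ₗ[ℝ] ℝ}
    {c : ℕ → (ℝ × EuclideanSpace ℝ (Fin d)) →ₗ[ℝ] (ℝ × EuclideanSpace ℝ (Fin d)) →ₗ[ℝ] ℝ}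
    {h : (ℝ × EuclideanSpace ℝ (Fin d)) →ₗ[ℝ] (ℝ × EuclideanSpace ℝ (Fin d)) →ₗ[ℝ] ℝ}
    (hr : ∀ u v, (fun ρ : ℝ => r ρ u v - (∑ k ∈ Finset.range (n + 1), ρ ^ k * c k u v)
      - ρ ^ n * Real.log ρ * h u v) =o[𝓝[>] 0] fun ρ : ℝ => ρ ^ n)
    (u v : ℝ × EuclideanSpace ℝ (Fin d)) :
    (fun ρ : ℝ => wickForm (r ρ) u v
      - (∑ k ∈ Finset.range (n + 1), ((ρ ^ k : ℝ) : ℂ) * wickForm (c k) u v)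
      - ((ρ ^ n * Real.log ρ : ℝ) : ℂ) * wickForm h u v) =o[𝓝[>] 0] fun ρ : ℝ => ρ ^ n := by
  have hr' := fun u v => Complex.isLittleO_ofReal_left.2 (hr u v)
  refine (((((hr' (timePart u) (timePart v)).const_mul_left (-1)).add
    ((hr' (timePart u) (spacePart v)).const_mul_left Complex.I)).add
    ((hr' (spacePart u) (timePart v)).const_mul_left Complex.I)).add
    (hr' (spacePart u) (spacePart v))).congr_left fun ρ => ?_
  simp only [wickForm_apply, mul_add, Finset.sum_add_distrib]
  push_cast
  simp only [mul_sub, Finset.mul_sum, mul_neg, Finset.sum_neg_distrib, mul_left_comm Complex.I]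
  ring_nf
  simp only [Finset.sum_neg_distrib]
  ring

/-- Although the Wick rotation is only required of the metrics `g_ρ` with `ρ > 0`, it holds for every
coefficient up to order `n`, because `wick` is real linear and expansions are unique. -/
theorem IsWickRotation.coeff_eq {n : ℕ} {l : ℝ}
    {M : Type*} [TopologicalSpace M] [ChartedSpace (EuclideanSpace ℝ (Fin (n + 1))) M]
    {M' : Type*} [TopologicalSpace M'] [ChartedSpace (EuclideanSpace ℝ (Fin (n + 1))) M']
    {B : Type*} [TopologicalSpace B] [ChartedSpace (EuclideanSpace ℝ (Fin n)) B]
    {S : Type*} [TopologicalSpace S] [ChartedSpace (EuclideanSpace ℝ (Fin d)) S]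
    {Ψ : ℝ × S → B} {Y : EinsteinEnd ℝ n 1 l M (𝓡 n) B}
    {Z : EinsteinEnd ℂ n 1 l M' (𝓘(ℝ, ℝ).prod (𝓡 d)) (ℝ × S)} (h : IsWickRotation Ψ Y Z)
    {k : ℕ} (hk : k ≤ n) : Z.coeff k = wick (pullback Ψ (Y.coeff k)) := by
  refine Z.expansion.coeff_unique (c' := fun k => wick (pullback Ψ (Y.coeff k)))
    (h' := wick (pullback Ψ Y.logCoeff)) (fun p u v => ?_) hk
  have key := wickForm_isLittleO (r := fun ρ => pullback Ψ (Y.family ρ) p)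
    (c := fun k => pullback Ψ (Y.coeff k) p) (h := pullback Ψ Y.logCoeff p)
    (fun u v => Y.expansion.asymptotic (Ψ p) (mfderiv (𝓘(ℝ, ℝ).prod (𝓡 d)) (𝓡 n) Ψ p u)
      (mfderiv (𝓘(ℝ, ℝ).prod (𝓡 d)) (𝓡 n) Ψ p v)) u v
  refine key.congr' ?_ EventuallyEq.rfl
  filter_upwards [Ioo_mem_nhdsGT Y.ε_pos, Ioo_mem_nhdsGT Z.ε_pos] with ρ h1 h2
  rw [h.family_eq ρ h1.1 h1.2 h2.2]
  rfl

end Wick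

/-! ### Transformation of the term `r_(n)` -/

section Algebra

variable {ι : Type*} [Fintype ι] [DecidableEq ι] {𝕜 : Type*} [RCLike 𝕜]

/-- `rTerm` is covariant under a change of frame. No nondegeneracy of `c 0` is needed, since
`(A * B)⁻¹ = B⁻¹ * A⁻¹` holds for all square matrices with Mathlib's convention. -/
theorem rTerm_conj (n : ℕ) {D : Matrix ι ι 𝕜} (hD : IsUnit D.det)
    {c c' : ℕ → Matrix ι ι 𝕜}
    (h : ∀ k ≤ n, c' k = D * c k * D) : rTerm n c' = D * rTerm n c * D := by
  have hinv : (D * c 0 * D)⁻¹ = D⁻¹ * (c 0)⁻¹ * D⁻¹ := by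
    rw [Matrix.mul_inv_rev, Matrix.mul_inv_rev, mul_assoc]
  have e1 : (D * c 0 * D)⁻¹ * (D * c 2 * D) = D⁻¹ * ((c 0)⁻¹ * c 2) * D := by
    rw [hinv]
    simp only [mul_assoc, nonsing_inv_mul_cancel_left _ _ hD]
  have t : ∀ X : Matrix ι ι 𝕜, (D⁻¹ * X * D).trace = X.trace := fun X => by
    rw [trace_mul_cycle, mul_nonsing_inv _ hD, one_mul]
  have e2 : D⁻¹ * ((c 0)⁻¹ * c 2) * D * (D⁻¹ * ((c 0)⁻¹ * c 2) * D)
      = D⁻¹ * ((c 0)⁻¹ * c 2 * ((c 0)⁻¹ * c 2)) * D := by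
    simp only [mul_assoc, mul_nonsing_inv_cancel_left _ _ hD]
  have e3 : D * c 2 * D * (D * c 0 * D)⁻¹ * (D * c 2 * D) = D * (c 2 * (c 0)⁻¹ * c 2) * D := by
    rw [hinv]
    simp only [mul_assoc, nonsing_inv_mul_cancel_left _ _ hD, mul_nonsing_inv_cancel_left _ _ hD]
  unfold rTerm
  split_ifs with h2 h4
  · rw [h 0 (by omega), h 2 (by omega), e1, t]
    simp
  · rw [h 0 (by omega), h 2 (by omega), e3, e1, e2, t, t]
    simp only [mul_add, mul_sub, add_mul, sub_mul, mul_neg, neg_mul, mul_smul_comm, smul_mul_assoc]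
  · simp

theorem map_ofReal_inv {A : Matrix ι ι ℝ} (hA : IsUnit A.det) :
    (A.map Complex.ofReal)⁻¹ = A⁻¹.map Complex.ofReal := by
  refine inv_eq_left_inv ?_
  have := congrArg (fun X => Matrix.map X Complex.ofRealHom) (nonsing_inv_mul A hA)
  rw [Matrix.map_mul] at this
  simpa using! this

theorem rTerm_map_ofReal (n : ℕ) {c : ℕ → Matrix ι ι ℝ} (h0 : IsUnit (c 0).det) :
    rTerm n (fun k => (c k).map Complex.ofReal) = (rTerm n c).map Complex.ofReal := by
  have hm : ∀ X Y : Matrix ι ι ℝ, X.map Complex.ofReal * Y.map Complex.ofReal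
      = (X * Y).map Complex.ofReal := fun X Y => (Matrix.map_mul (f := Complex.ofRealHom)).symm
  have ht : ∀ X : Matrix ι ι ℝ, (X.map Complex.ofReal).trace = (X.trace : ℂ) := fun X => by
    simp [trace]
  unfold rTerm
  simp only [map_ofReal_inv h0, hm, ht]
  split_ifs
  all_goals
    ext i j
    simp

/-- Under `ρ → iρ`, `r_(n)` acquires the same sign as `g_(n)`: it is linear in `g_(2)` for `n = 2`
and quadratic in `g_(2)` for `n = 4`. -/
theorem rTerm_continuation {n : ℕ} (hn : Odd n ∨ n = 2 ∨ n = 4) {c c' : ℕ → Matrix ι ι 𝕜}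
    (h : ∀ k ≤ n, c k = (continuationSign k : 𝕜) • c' k) :
    rTerm n c = (continuationSign n : 𝕜) • rTerm n c' := by
  have s0 : continuationSign 0 = 1 := by simp [continuationSign]
  have s2 : continuationSign 2 = -1 := by simp [continuationSign]
  have s4 : continuationSign 4 = 1 := by simp [continuationSign]
  rcases hn with ho | rfl | rfl
  · have h2 : n ≠ 2 := by rintro rfl; revert ho; decide
    have h4 : n ≠ 4 := by rintro rfl; revert ho; decide
    simp [rTerm, h2, h4]
  · simp [rTerm, h 0, h 2, s0, s2]
  · simp [rTerm, h 0, h 2, s0, s2, s4]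

end Algebra

/-! ### Unit normals and the mass density -/

section Normal

variable {d : ℕ} {γ : Matrix (Unit ⊕ Fin d) (Unit ⊕ Fin d) ℝ}

/-- The covector `γ(ν, ·)` vanishes on the slice, and the normalization of `ν` fixes its remaining
component. -/
theorem IsUnitNormal.mulVec_eq {𝕜 : Type*} [RCLike 𝕜] {κ : ℝ}
    {γ : Matrix (Unit ⊕ Fin d) (Unit ⊕ Fin d) 𝕜} {ν : Unit ⊕ Fin d → 𝕜}
    (h : IsUnitNormal κ γ ν) :
    γ *ᵥ ν = Pi.single (Sum.inl ()) ((κ : 𝕜) / ν (Sum.inl ())) := by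
  obtain ⟨a, ha, hν⟩ := h.pos
  have h0 : ν (Sum.inl ()) ≠ 0 := by
    rw [hν]
    exact_mod_cast ha.ne'
  have h1 := h.norm_eq
  simp only [dotProduct, Fintype.sum_sum_type, h.orthogonal, mul_zero, Finset.sum_const_zero,
    add_zero, Finset.univ_unique, Finset.sum_singleton] at h1
  ext (i | i)
  · rw [Pi.single_eq_same, eq_div_iff h0, mul_comm]
    exact h1
  · rw [h.orthogonal, Pi.single_eq_of_ne (by simp)]

/-- The unit normal `ν'` of the Wick rotated metric is `ν' = diag(1, i, …, i) ν`. Both `ν` and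
`diag(i, 1, …, 1) ν'` solve the linear system of `IsUnitNormal.mulVec_eq` for `γ`, hence are
proportional; that both normals point along `K` selects the factor `i` rather than `-i`. -/
theorem IsUnitNormal.wickMatrix_mulVec (hγ : IsUnit γ.det) {ν : Unit ⊕ Fin d → ℝ}
    {ν' : Unit ⊕ Fin d → ℂ} (h : IsUnitNormal 1 γ ν)
    (h' : IsUnitNormal (-1) (wickMatrix d * γ.map Complex.ofReal * wickMatrix d) ν') :
    wickMatrix d *ᵥ ν' = Complex.I • fun i => (ν i : ℂ) := by
  obtain ⟨a, ha, hν⟩ := h.pos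
  obtain ⟨a', ha', hν'⟩ := h'.pos
  have hinj : Function.Injective (wickMatrix d *ᵥ ·) :=
    mulVec_injective_iff_isUnit.2 ((isUnit_iff_isUnit_det _).2 isUnit_det_wickMatrix)
  have hγC : IsUnit (γ.map Complex.ofReal).det := by
    have := hγ.map Complex.ofRealHom
    rwa [RingHom.map_det] at this
  have hγinj : Function.Injective (γ.map Complex.ofReal *ᵥ ·) :=
    mulVec_injective_iff_isUnit.2 ((isUnit_iff_isUnit_det _).2 hγC)
  have e1 : γ.map Complex.ofReal *ᵥ (fun i => (ν i : ℂ))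
      = Pi.single (Sum.inl ()) ((1 / a : ℝ) : ℂ) := by
    have := h.mulVec_eq
    rw [hν] at this
    ext i
    have h2 := congrArg Complex.ofReal (congrFun this i)
    simp only [mulVec, dotProduct, Complex.ofReal_sum, Complex.ofReal_mul] at h2
    simp only [mulVec, dotProduct, map_apply]
    rw [h2]
    rcases i with i | i <;> simp
  have e2 : γ.map Complex.ofReal *ᵥ (wickMatrix d *ᵥ ν')
      = ((a / a' : ℝ) : ℂ) • Complex.I • Pi.single (Sum.inl ()) ((1 / a : ℝ) : ℂ) := by
    apply hinj
    have := h'.mulVec_eq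
    rw [hν', ← mulVec_mulVec, ← mulVec_mulVec] at this
    simp only [this]
    ext (i | i) <;> simp [wickMatrix, mulVec_diagonal]
    have : (a : ℂ) ≠ 0 := by exact_mod_cast ha.ne'
    have : (a' : ℂ) ≠ 0 := by exact_mod_cast ha'.ne'
    field_simp
    simp
  have e3 : wickMatrix d *ᵥ ν' = ((a / a' : ℝ) : ℂ) • Complex.I • fun i => (ν i : ℂ) := by
    apply hγinj
    simp only
    rw [e2, mulVec_smul, mulVec_smul, e1]
  have e4 := congrFun e3 (Sum.inl ())
  simp only [wickMatrix, mulVec_diagonal, Sum.elim_inl, Pi.smul_apply, smul_eq_mul, hν', hν] at e4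
  rw [mul_left_comm] at e4
  have e5 : a' = a / a' * a := Complex.ofReal_injective <| by
    simpa using mul_left_cancel₀ Complex.I_ne_zero e4
  -- `a' ^ 2 = a ^ 2` with both positive
  have e6 : a' = a := by
    field_simp at e5
    nlinarith
  rw [e3, e6, div_self ha.ne', Complex.ofReal_one, one_smul]

/-- The mass densities agree up to `continuationSign n`. One factor `i` comes from the `K`-component
of `T(·, ν')` and one from the normal; their product `-1` cancels the opposite signs `∓` in the
definitions of the two stress-energy tensors. -/
theorem stressEnergy_continuation {n : ℕ} (hn : Odd n ∨ n = 2 ∨ n = 4) (G : ℝ)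
    {A A' : ℕ → Matrix (Unit ⊕ Fin d) (Unit ⊕ Fin d) ℝ}
    {C : ℕ → Matrix (Unit ⊕ Fin d) (Unit ⊕ Fin d) ℂ} (hdet : IsUnit (A 0).det)
    (hA : ∀ k ≤ n, A k = continuationSign k • A' k)
    (hC : ∀ k ≤ n, C k = wickMatrix d * (A' k).map Complex.ofReal * wickMatrix d)
    {ν : Unit ⊕ Fin d → ℝ} {ν' : Unit ⊕ Fin d → ℂ}
    (hν : IsUnitNormal 1 (A 0) ν) (hν' : IsUnitNormal (-1) (C 0) ν') :
    (((stressEnergy (-1) n G A *ᵥ ν) (Sum.inl ()) : ℝ) : ℂ)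
      = continuationSign n * (stressEnergy 1 n G C *ᵥ ν') (Sum.inl ()) := by
  have hA0 : A 0 = A' 0 := by simpa [continuationSign] using hA 0 (Nat.zero_le n)
  rw [hA0] at hν hdet
  rw [hC 0 (Nat.zero_le n)] at hν'
  have hr : rTerm n C = wickMatrix d * (rTerm n A').map Complex.ofReal * wickMatrix d := by
    rw [rTerm_conj n isUnit_det_wickMatrix hC, rTerm_map_ofReal n hdet]
  have hτ : C n + rTerm n C
      = wickMatrix d * (A' n + rTerm n A').map Complex.ofReal * wickMatrix d := by
    rw [hC n le_rfl, hr, Matrix.map_add _ Complex.ofReal_add, mul_add, add_mul]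
  have hτ' : A n + rTerm n A = continuationSign n • (A' n + rTerm n A') := by
    rw [hA n le_rfl, rTerm_continuation hn hA, smul_add]
    rfl
  have hre : ((A' n + rTerm n A').map Complex.ofReal *ᵥ fun i => (ν i : ℂ)) (Sum.inl ())
      = (((A' n + rTerm n A') *ᵥ ν) (Sum.inl ()) : ℝ) := by
    simp [mulVec, dotProduct]
  rw [stressEnergy, stressEnergy, hτ, hτ', smul_mulVec, smul_mulVec, smul_mulVec,
    ← mulVec_mulVec, ← mulVec_mulVec, hν.wickMatrix_mulVec hdet hν', mulVec_smul, mulVec_smul]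
  simp only [Pi.smul_apply, wickMatrix, mulVec_diagonal, Sum.elim_inl, hre, smul_eq_mul]
  push_cast
  simp only [RCLike.ofReal_real_eq_id, id, Complex.coe_algebraMap]
  linear_combination
    -(continuationSign n * (n / (16 * Real.pi * G)) * (((A' n + rTerm n A') *ᵥ ν) (Sum.inl ()) : ℝ) : ℂ)
      * Complex.I_sq

end Normal

/-! ### The volume measure and nondegeneracy of the boundary metric -/

section Volume

/-- The condition on chart domains determines the volume measure, because countably many chart domains
cover a second countable manifold. -/
theorem IsRiemannianVolume.unique {d : ℕ} {S : Type*} [TopologicalSpace S]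
    [SecondCountableTopology S] [ChartedSpace (EuclideanSpace ℝ (Fin d)) S] [MeasurableSpace S]
    [BorelSpace S] {h : FormField ℝ (𝓡 d) S} {μ μ' : Measure S}
    (hμ : IsRiemannianVolume h μ) (hμ' : IsRiemannianVolume h μ') : μ = μ' := by
  obtain ⟨t, ht, hcov⟩ := TopologicalSpace.countable_cover_nhds
    (fun x : S => extChartAt_source_mem_nhds (I := 𝓡 d) x)
  refine (Measure.ext_iff_of_biUnion_eq_univ ht hcov).2 fun x _ => ?_
  have hm : MeasurableSet (extChartAt (𝓡 d) x).source := (isOpen_extChartAt_source x).measurableSet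
  ext A hA
  rw [Measure.restrict_apply hA, Measure.restrict_apply hA,
    hμ x _ (hA.inter hm) Set.inter_subset_right, hμ' x _ (hA.inter hm) Set.inter_subset_right]

theorem isUnit_det_sliceComp {d : ℕ} {S : Type*} [TopologicalSpace S]
    [ChartedSpace (EuclideanSpace ℝ (Fin d)) S]
    {q : FormField ℝ (𝓘(ℝ, ℝ).prod (𝓡 d)) (ℝ × S)}
    (hq : ∀ (p : ℝ × S) (u : ℝ × EuclideanSpace ℝ (Fin d)), u ≠ 0 → 0 < q p u u) (x : S) :
    IsUnit (sliceComp q x).det := by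
  rw [← isUnit_iff_isUnit_det, ← mulVec_injective_iff_isUnit]
  have key (r : (ℝ × EuclideanSpace ℝ (Fin d)) →ₗ[ℝ] (ℝ × EuclideanSpace ℝ (Fin d)) →ₗ[ℝ] ℝ)
      (hr : ∀ u, u ≠ 0 → 0 < r u u) (e : Unit ⊕ Fin d → ℝ × EuclideanSpace ℝ (Fin d))
      (he : LinearIndependent ℝ e) :
      Function.Injective ((of fun i j => r (e i) (e j)) *ᵥ ·) := by
    rw [← coe_mulVecLin, injective_iff_map_eq_zero]
    intro v hv
    have hq : r (∑ i, v i • e i) (∑ i, v i • e i) = v ⬝ᵥ ((of fun i j => r (e i) (e j)) *ᵥ v) := by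
      simp only [map_sum, map_smul, LinearMap.sum_apply, LinearMap.smul_apply, dotProduct, mulVec,
        of_apply, smul_eq_mul, Finset.mul_sum]
      rw [Finset.sum_comm]
      exact Finset.sum_congr rfl fun i _ => Finset.sum_congr rfl fun j _ => by ring
    have hv' : (of fun i j => r (e i) (e j)) *ᵥ v = 0 := hv
    rw [hv', dotProduct_zero] at hq
    by_contra hne
    refine (hr _ fun h0 => hne ?_).ne' hq
    exact funext (Fintype.linearIndependent_iff.1 he v h0)
  refine key (q (0, x)) (hq (0, x)) _ (Fintype.linearIndependent_iff.2 fun v hv => ?_)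
  rw [Fintype.sum_sum_type] at hv
  rintro (i | i)
  · simpa [Prod.fst_sum] using congrArg Prod.fst hv
  · simpa [Prod.snd_sum, Pi.single_apply] using congrArg (fun w => w.2 i) hv

end Volume

/-! ### Comparison of the masses -/

section Mass

variable {n d : ℕ} {l : ℝ}
  {M : Type*} [TopologicalSpace M] [ChartedSpace (EuclideanSpace ℝ (Fin (n + 1))) M]
  {M' : Type*} [TopologicalSpace M'] [ChartedSpace (EuclideanSpace ℝ (Fin (n + 1))) M']
  {M'' : Type*} [TopologicalSpace M''] [ChartedSpace (EuclideanSpace ℝ (Fin (n + 1))) M'']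
  {B : Type*} [TopologicalSpace B] [ChartedSpace (EuclideanSpace ℝ (Fin n)) B]
  {S : Type*} [TopologicalSpace S] [ChartedSpace (EuclideanSpace ℝ (Fin d)) S]

/-- The relation of the masses in all cases at once; it is stated for a slice of arbitrary dimension
`d`, with only injectivity required of the differential of `Ψ`. -/
theorem mass_eq_continuationSign_mul [SecondCountableTopology S] [MeasurableSpace S] [BorelSpace S]
    (hn : Odd n ∨ n = 2 ∨ n = 4) (G : ℝ)
    {dS : EinsteinEnd ℝ n (-1) l M (𝓡 n) B} (hγ : IsRiemannian (dS.coeff 0))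
    {Ψ : ℝ × S → B}
    (hΨ : ∀ p, Function.Injective (mfderiv (𝓘(ℝ, ℝ).prod (𝓡 d)) (𝓡 n) Ψ p))
    {AH : EinsteinEnd ℝ n 1 l M' (𝓡 n) B} (hcont : IsContinuation dS AH)
    {AdS : EinsteinEnd ℂ n 1 l M'' (𝓘(ℝ, ℝ).prod (𝓡 d)) (ℝ × S)}
    (hwick : IsWickRotation Ψ AH AdS) {m_dS : ℝ} {m_AdS : ℂ}
    (hm_dS : HasMass (-1) 1 n G (fun k => pullback (d := d) Ψ (dS.coeff k)) m_dS)
    (hm_AdS : HasMass 1 (-1) n G AdS.coeff m_AdS) :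
    (m_dS : ℂ) = continuationSign n * m_AdS := by
  obtain ⟨dA, ν, hdA, hν, -, rfl⟩ := hm_dS
  obtain ⟨dA', ν', hdA', hν', -, rfl⟩ := hm_AdS
  have h0 : pullback (d := d) Ψ (dS.coeff 0) = pullback Ψ (AH.coeff 0) := by
    rw [show dS.coeff 0 = AH.coeff 0 from funext fun b => by
      simpa [continuationSign] using hcont.coeff_eq 0 (Nat.zero_le n) b]
  have hmeasure : dA = dA' := by
    rw [hwick.coeff_eq (Nat.zero_le n), sliceMetric_wick, ← h0] at hdA'
    exact hdA.unique hdA'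
  have hpos : ∀ (p : ℝ × S) (u : ℝ × EuclideanSpace ℝ (Fin d)), u ≠ 0 →
      0 < pullback Ψ (dS.coeff 0) p u u := fun p u hu =>
    hγ (Ψ p) _ fun h => hu (hΨ p (h.trans (map_zero _).symm))
  rw [← hmeasure, ← integral_complex_ofReal, ← integral_const_mul]
  refine integral_congr_ae (ae_of_all _ fun x => ?_)
  refine stressEnergy_continuation hn G (A' := fun k => sliceComp (pullback Ψ (AH.coeff k)) x)
    (isUnit_det_sliceComp hpos x) (fun k hk => ?_) (fun k hk => ?_) (hν x) (hν' x)
  · ext i j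
    simp only [sliceComp, pullback, hcont.coeff_eq k hk]
    rfl
  · rw [hwick.coeff_eq hk, sliceComp_wick]

end Mass

end Holographic

theorem proposition5p1
    -- dimension `n + 1` of the spacetimes, length scale, Newton's constant
    (n : ℕ) (hn : 2 ≤ n) (l G : ℝ) (hl : 0 < l) (hG : 0 < G)
    -- the spacetime `(M, g)` of de Sitter type, with conformal infinity `B`
    {M : Type*} [TopologicalSpace M] [T2Space M] [SecondCountableTopology M]
    [ChartedSpace (EuclideanSpace ℝ (Fin (n + 1))) M] [IsManifold (𝓡 (n + 1)) ∞ M]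
    {B : Type*} [TopologicalSpace B] [T2Space B] [SecondCountableTopology B]
    [ChartedSpace (EuclideanSpace ℝ (Fin n)) B] [IsManifold (𝓡 n) ∞ B]
    (dS : EinsteinEnd ℝ n (-1) l M (𝓡 n) B)
    (hdS : IsLorentzian dS.metric) (hγ : IsRiemannian (dS.coeff 0))
    -- its stationary Killing field `K` on `B`, with a slice `S` to the orbits
    {S : Type*} [TopologicalSpace S] [T2Space S] [SecondCountableTopology S]
    [ChartedSpace (EuclideanSpace ℝ (Fin (n - 1))) S] [IsManifold (𝓡 (n - 1)) ∞ S]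
    [MeasurableSpace S] [BorelSpace S]
    (K : (b : B) → TangentSpace (𝓡 n) b) (Ψ : ℝ × S → B) (hΨ : IsSlice (d := n - 1) K Ψ)
    (hK : IsTranslationInvariant (pullback (d := n - 1) Ψ (dS.coeff 0)))
    -- its asymptotically hyperbolic continuation
    {M' : Type*} [TopologicalSpace M'] [T2Space M'] [SecondCountableTopology M']
    [ChartedSpace (EuclideanSpace ℝ (Fin (n + 1))) M'] [IsManifold (𝓡 (n + 1)) ∞ M']
    (AH : EinsteinEnd ℝ n 1 l M' (𝓡 n) B) (hAH : IsRiemannian AH.metric)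
    (hcont : IsContinuation dS AH)
    -- the associated anti-de Sitter metric
    {M'' : Type*} [TopologicalSpace M''] [T2Space M''] [SecondCountableTopology M'']
    [ChartedSpace (EuclideanSpace ℝ (Fin (n + 1))) M''] [IsManifold (𝓡 (n + 1)) ∞ M'']
    (AdS : EinsteinEnd ℂ n 1 l M'' (𝓘(ℝ, ℝ).prod (𝓡 (n - 1))) (ℝ × S))
    (hwick : IsWickRotation (d := n - 1) Ψ AH AdS)
    -- the holographic masses
    (m_dS : ℝ) (hm_dS : HasMass (d := n - 1) (-1) 1 n G (fun k => pullback (d := n - 1) Ψ (dS.coeff k)) m_dS)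
    (m_AdS : ℂ) (hm_AdS : HasMass (d := n - 1) 1 (-1) n G AdS.coeff m_AdS) :
    (n % 4 = 3 → (m_dS : ℂ) = -m_AdS) ∧
    (n % 4 = 1 → (m_dS : ℂ) = m_AdS) ∧
    (n = 2 → (m_dS : ℂ) = -m_AdS) ∧
    (n = 4 → (m_dS : ℂ) = m_AdS) := by
  have key : Odd n ∨ n = 2 ∨ n = 4 → (m_dS : ℂ) = continuationSign n * m_AdS := fun h =>
    mass_eq_continuationSign_mul h G hγ (fun p => (hΨ.bijective_mfderiv p).injective) hcont hwick
      hm_dS hm_AdS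
  refine ⟨fun h => ?_, fun h => ?_, fun h => ?_, fun h => ?_⟩
  · rw [key (Or.inl (Nat.odd_iff.2 (by omega)))]
    simp [continuationSign, h]
  · rw [key (Or.inl (Nat.odd_iff.2 (by omega)))]
    simp [continuationSign, h]
  · rw [key (Or.inr (Or.inl h))]
    simp [continuationSign, h]
  · rw [key (Or.inr (Or.inr h))]
    simp [continuationSign, h]
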